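/- Words are ordered lexicographically with respect to a total order on the alphabet. A non-empty word is a \emph{Lyndon word} if it is strictly smaller than each of its non-empty proper suffixes. The \emph{standard factorization} of a Lyndon word $w$ with $|w|\ge 2$ is the pair $(u,v)$ with $w=uv$ such that $v$ is the longest proper suffix of $w$ that is a Lyndon word. The \emph{Lyndon tree} of a Lyndon word $w$ is the ordered full binary tree with root labeled $w$ that is a single node if $|w|=1$, and otherwise has the Lyndon trees of $u$ and of $v$ as its left and right subtrees. A \emph{straight-line program} (SLP) is a list of rules for variables $X_1,\dots,X_k$, each of the form $X_i\to a$ with a character $a$ or $X_i\to X_\ell X_r$ with $\ell,r<i$, in which every variable is reachable from the start symbol $X_k$; $\mathrm{val}(X_i)$ is the word derived by $X_i$, the SLP represents $\mathrm{val}(X_k)$, and its size is the total length of the right-hand sides. A \emph{Lyndon SLP} of a Lyndon word $T$ is an SLP representing $T$ such that every $\mathrm{val}(X_i)$ is a Lyndon word, $(\mathrm{val}(X_\ell),\mathrm{val}(X_r))$ is the standard factorization of $\mathrm{val}(X_i)$ for every rule $X_i\to X_\ell X_r$, and distinct variables derive distinct words. \textbf{Lemma.} There are a word-RAM program $P$ and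 a constant $C$ such that the following holds. Let $T=T[1..n]$ be a Lyndon word over a totally ordered alphabet, let $\mathcal G$ be a Lyndon SLP of $T$, let $g$ be its size, and let the machine word size be $w\ge \lceil\lg n\rceil+C$ bits. Then there is a data structure of at most $C g$ machine words (in a memory of $2^w$ words) on which $P$ answers every query $i\in[1..n]$ in at most $C(\lfloor\lg n\rfloor+1)$ steps, that is, in $O(\lg n)$ time for $n \ge 2$, by returning the longest Lyndon word that starts at $T[i]$: it returns the length of this word, which is the $i$-th entry of the Lyndon array of $T$, and the index of a variable of $\mathcal G$ that derives this word. Moreover, this word is the label of the highest node of the Lyndon tree of $T$ whose leftmost leaf is (the one for) $T[i]$. -/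

import Mathlib

namespace LyndonSLP

/-! ### Lyndon words and Lyndon trees

The order `<` on `List α` is the lexicographic order induced by the order of the alphabet `α`
(a proper prefix of a word is smaller than the word). -/

/-- `w` is non-empty and strictly smaller than each of its non-empty proper suffixes. -/
def IsLyndon {α : Type*} [LinearOrder α] (w : List α) : Prop :=
  w ≠ [] ∧ ∀ u : List α, u <:+ w → u ≠ [] → u ≠ w → w < u

/-- `(u, v)` is the standard factorization of `w`: `w = uv`, and `v` is the longest proper suffix
of `w` that is a Lyndon word. -/
def IsStandardFactorization {α : Type*} [LinearOrder α] (w u v : List α) : Prop :=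
  w = u ++ v ∧ v ≠ w ∧ IsLyndon v ∧
    ∀ v' : List α, v' <:+ w → v' ≠ w → IsLyndon v' → v'.length ≤ v.length

/-- `u` is the longest Lyndon word that starts at position `i` (counted from 1) of `T`.
Its length is the `i`-th entry of the Lyndon array of `T`. -/
def IsLongestLyndonAt {α : Type*} [LinearOrder α] (T : List α) (i : ℕ) (u : List α) : Prop :=
  IsLyndon u ∧ u <+: T.drop (i - 1) ∧
    ∀ v : List α, IsLyndon v → v <+: T.drop (i - 1) → v.length ≤ u.length

/-- Ordered full binary trees whose nodes are labeled by words. -/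
inductive LTree (α : Type*) where
  | leaf (label : List α) : LTree α
  | node (label : List α) (left right : LTree α) : LTree α

/-- The label of the root. -/
def LTree.label {α : Type*} : LTree α → List α
  | .leaf w => w
  | .node w _ _ => w

/-- `IsLyndonTree w t`: the tree `t` is the Lyndon tree of the Lyndon word `w`. -/
inductive IsLyndonTree {α : Type*} [LinearOrder α] : List α → LTree α → Prop
  | single (a : α) : IsLyndonTree [a] (.leaf [a])
  | split (w u v : List α) (l r : LTree α) (hw : IsLyndon w) (hlen : 2 ≤ w.length)
      (hf : IsStandardFactorization w u v) (hl : IsLyndonTree u l) (hr : IsLyndonTree v r) :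
      IsLyndonTree w (.node w l r)

/-- `t.NodeAt d i s`: the tree `t` has a node of depth `d` whose subtree is `s` and whose leftmost
leaf is the `i`-th leaf of `t` (counted from 1). Here the number of leaves below a node is the
length of its label, as is the case in Lyndon trees. -/
inductive LTree.NodeAt {α : Type*} : LTree α → ℕ → ℕ → LTree α → Prop
  | root (t : LTree α) : NodeAt t 0 1 t
  | left (w : List α) (l r s : LTree α) (d i : ℕ) (h : NodeAt l d i s) :
      NodeAt (.node w l r) (d + 1) i s
  | right (w : List α) (l r s : LTree α) (d i : ℕ) (h : NodeAt r d i s) :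
      NodeAt (.node w l r) (d + 1) (l.label.length + i) s

/-- `s` is the subtree of the highest node of `t` whose leftmost leaf is the `i`-th leaf. -/
def LTree.IsHighestAt {α : Type*} (t : LTree α) (i : ℕ) (s : LTree α) : Prop :=
  ∃ d : ℕ, t.NodeAt d i s ∧ ∀ (d' : ℕ) (s' : LTree α), t.NodeAt d' i s' → d ≤ d'

/-! ### Straight-line programs -/

/-- The right-hand side of a rule of an SLP with `k` variables. -/
inductive Rule (α : Type*) (k : ℕ) where
  | char (a : α) : Rule α k
  | pair (l r : Fin k) : Rule α k

/-- The length of the right-hand side. -/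
def Rule.length {α : Type*} {k : ℕ} : Rule α k → ℕ
  | .char _ => 1
  | .pair _ _ => 2

/-- The variable `X` occurs in the right-hand side. -/
def Rule.Uses {α : Type*} {k : ℕ} : Rule α k → Fin k → Prop
  | .char _, _ => False
  | .pair l r, X => X = l ∨ X = r

/-- A straight-line program: an admissible grammar in Chomsky normal form. The variables are
numbered `0, …, numVars - 1`, the last one is the start symbol, a right-hand side uses only smaller
variables, and there are no useless variables. -/
structure SLP (α : Type*) where
  numVars : ℕ
  numVars_pos : 0 < numVars
  rule : Fin numVars → Rule α numVars
  acyclic : ∀ X Y : Fin numVars, (rule X).Uses Y → Y < X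
  useful : ∀ Y : Fin numVars, Relation.ReflTransGen (fun A B => (rule A).Uses B)
    ⟨numVars - 1, Nat.sub_lt numVars_pos Nat.one_pos⟩ Y

/-- The start symbol. -/
def SLP.start {α : Type*} (G : SLP α) : Fin G.numVars :=
  ⟨G.numVars - 1, Nat.sub_lt G.numVars_pos Nat.one_pos⟩

/-- The string derived by a variable. -/
def SLP.val {α : Type*} (G : SLP α) (X : Fin G.numVars) : List α :=
  match h : G.rule X with
  | .char a => [a]
  | .pair l r => G.val l ++ G.val r
termination_by X.val
decreasing_by
  · exact G.acyclic X l (by rw [h]; exact Or.inl rfl)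
  · exact G.acyclic X r (by rw [h]; exact Or.inr rfl)

/-- The size of an SLP: the total length of the right-hand sides. -/
def SLP.size {α : Type*} (G : SLP α) : ℕ := ∑ X : Fin G.numVars, (G.rule X).length

/-- `G` is a Lyndon SLP representing `T`. -/
structure SLP.IsLyndonSLPOf {α : Type*} [LinearOrder α] (G : SLP α) (T : List α) : Prop where
  represents : G.val G.start = T
  lyndon : ∀ X : Fin G.numVars, IsLyndon (G.val X)
  standard : ∀ X l r : Fin G.numVars, G.rule X = .pair l r →
    IsStandardFactorization (G.val X) (G.val l) (G.val r)
  distinct : Function.Injective G.val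

/-! ### The word RAM -/

/-- The binary word operations; each takes unit time. -/
inductive Op where
  | add | sub | mul | div | mod | and | or | xor | shl | shr

/-- The instructions. Registers and jump targets are fixed in the program; memory is addressed
indirectly, through registers. -/
inductive Instr where
  /-- `R[d] := c` -/
  | const (d c : ℕ) : Instr
  /-- `R[d] := R[a] o R[b]` -/
  | op (o : Op) (d a b : ℕ) : Instr
  /-- `R[d] := M[R[a]]` -/
  | load (d a : ℕ) : Instr
  /-- `M[R[a]] := R[b]` -/
  | store (a b : ℕ) : Instr
  /-- unconditional jump to instruction `l` -/
  | jmp (l : ℕ) : Instr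
  /-- jump to instruction `l` if `R[a] = R[b]` -/
  | jeq (a b l : ℕ) : Instr
  /-- jump to instruction `l` if `R[a] < R[b]` (as unsigned numbers) -/
  | jlt (a b l : ℕ) : Instr
  | halt : Instr

/-- A configuration of the word RAM with `w`-bit words: program counter, registers, memory. -/
structure Config (w : ℕ) where
  pc : ℕ
  reg : ℕ → BitVec w
  mem : BitVec w → BitVec w

/-- Arithmetic is unsigned and modulo `2 ^ w`. -/
def Op.eval {w : ℕ} : Op → BitVec w → BitVec w → BitVec w
  | .add, x, y => x + y
  | .sub, x, y => x - y
  | .mul, x, y => x * y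
  | .div, x, y => x / y
  | .mod, x, y => x % y
  | .and, x, y => x &&& y
  | .or, x, y => x ||| y
  | .xor, x, y => x ^^^ y
  | .shl, x, y => x <<< y
  | .shr, x, y => x >>> y

/-- The effect of one instruction; `none` for `halt`. -/
def Instr.exec {w : ℕ} : Instr → Config w → Option (Config w)
  | .const d c, s =>
      some ⟨s.pc + 1, Function.update s.reg d (BitVec.ofNat w c), s.mem⟩
  | .op o d a b, s =>
      some ⟨s.pc + 1, Function.update s.reg d (o.eval (s.reg a) (s.reg b)), s.mem⟩
  | .load d a, s =>
      some ⟨s.pc + 1, Function.update s.reg d (s.mem (s.reg a)), s.mem⟩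
  | .store a b, s =>
      some ⟨s.pc + 1, s.reg, Function.update s.mem (s.reg a) (s.reg b)⟩
  | .jmp l, s => some ⟨l, s.reg, s.mem⟩
  | .jeq a b l, s => some ⟨if s.reg a = s.reg b then l else s.pc + 1, s.reg, s.mem⟩
  | .jlt a b l, s =>
      some ⟨if (s.reg a).toNat < (s.reg b).toNat then l else s.pc + 1, s.reg, s.mem⟩
  | .halt, _ => none

/-- One step of the program `P`; `none` if the machine has halted. -/
def step {w : ℕ} (P : List Instr) (s : Config w) : Option (Config w) :=
  (P[s.pc]?).bind fun I => I.exec s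

/-- `HaltsIn P t s s'`: started in `s`, the program `P` halts in `s'` after exactly `t` steps. -/
inductive HaltsIn {w : ℕ} (P : List Instr) : ℕ → Config w → Config w → Prop
  | done (s : Config w) (h : step P s = none) : HaltsIn P 0 s s
  | next (t : ℕ) (s s₁ s' : Config w) (h : step P s = some s₁) (h' : HaltsIn P t s₁ s') :
      HaltsIn P (t + 1) s s'

/-- The initial configuration of a query: the data structure `D` occupies the memory cells
`0, …, D.length - 1`, the query `i` is in register `0`, and everything else is `0`. -/
def queryConfig {w : ℕ} (D : List (BitVec w)) (i : ℕ) : Config w where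
  pc := 0
  reg := fun r => if r = 0 then BitVec.ofNat w i else 0
  mem := fun a => D.getD a.toNat 0

end LyndonSLP

namespace LyndonSLP

/-! ### Lyndon words -/

section Words

variable {α : Type*}

/-! Since every rule of a Lyndon SLP is a standard factorization, the parse tree is the Lyndon tree.
A Lyndon word that starts inside the left factor `u` of `w = uv` at an offset `j > 0` cannot reach
into `v`: it would overlap the Lyndon word `v`, and merging the two gives a Lyndon suffix of `w`
longer than `v` (`IsLongestLyndonAt.of_left`). By induction the longest Lyndon word at a position is
the label of the highest node whose leftmost leaf is there, so a query only has to find that node.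

The parse tree may be deep, so the search follows a symmetric centroid decomposition of the grammar.
An edge is heavy if both the length and the number of occurrences in the parse tree keep their
binary logarithm. Heavy edges form disjoint paths of variables (`Heavy.parent_unique`,
`not_heavy_right`), and every other edge lowers the potential `pot`, which starts at no more than `2
log n` (`pot_lt`, `pot_start_le`). The subtrees hanging off a path cut its word into segments, at
most two per variable of the path (`exists_segments`). A search tree on these segments places one of
length `ℓ` at depth at most `log len - log ℓ` (`exists_searchTree`). These costs telescope along a
query, which leaves at most `3 log n` moves (`exists_nav`). A position that starts a segment is
answered from a stored value; one strictly inside a segment is translated into the path of the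
hanging child. `Run.halts` executes each move in at most 16 machine steps. -/

theorem prefix_append_cases {y a b : List α} (h : y <+: a ++ b) :
    y <+: a ∨ ∃ t, y = a ++ t ∧ t <+: b := by
  obtain ⟨z, hz⟩ := h
  rcases List.append_eq_append_iff.1 hz with ⟨t, rfl, -⟩ | ⟨t, rfl, rfl⟩
  · exact Or.inl (List.prefix_append _ _)
  · exact Or.inr ⟨t, rfl, List.prefix_append _ _⟩

theorem suffix_append_cases {y a b : List α} (h : y <:+ a ++ b) :
    y <:+ b ∨ ∃ t, y = t ++ b ∧ t <:+ a := by
  obtain ⟨z, hz⟩ := h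
  rcases List.append_eq_append_iff.1 hz with ⟨t, rfl, rfl⟩ | ⟨t, rfl, rfl⟩
  · exact Or.inr ⟨t, rfl, List.suffix_append _ _⟩
  · exact Or.inl (List.suffix_append _ _)

variable [LinearOrder α]

/-- The length condition excludes that `a` is a proper prefix of `b`, so the comparison is decided
at a mismatch and the appended words do not matter. -/
theorem append_lt_append_of_lt_of_length_le (c d : List α) :
    ∀ {a b : List α}, a < b → b.length ≤ a.length → a ++ c < b ++ d
  | _, [], h, _ => absurd h (List.not_lt_nil _)
  | [], _ :: _, _, hl => by simp at hl
  | x :: a, y :: b, h, hl => by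
    rw [List.cons_lt_cons_iff] at h
    simp only [List.cons_append, List.cons_lt_cons_iff]
    rcases h with h | ⟨rfl, h⟩
    · exact Or.inl h
    · exact Or.inr ⟨rfl, append_lt_append_of_lt_of_length_le c d h (by simpa using hl)⟩

/-- Two overlapping Lyndon words merge into a Lyndon word. -/
theorem IsLyndon.append_of_overlap {x y z : List α} (hx : x ≠ []) (hy : y ≠ [])
    (hxy : IsLyndon (x ++ y)) (hyz : IsLyndon (y ++ z)) : IsLyndon (x ++ y ++ z) := by
  have key : ∀ t : List α, t <:+ x ++ y → t ≠ [] → t ≠ x ++ y → x ++ y ++ z < t ++ z :=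
    fun t ht h0 h1 =>
      append_lt_append_of_lt_of_length_le z z (hxy.2 t ht h0 h1) ht.length_le
  refine ⟨by simp [hx], fun u hu h0 h1 => ?_⟩
  rcases suffix_append_cases hu with h | ⟨t, rfl, ht⟩
  -- Here `u` is a suffix of `z`, and the chain is `xyz < yz < u`, each inequality coming from one
  -- of the two Lyndon words.
  · have hlt : x ++ y ++ z < y ++ z :=
      key y (List.suffix_append x y) hy (by simpa using Ne.symm hx)
    refine hlt.trans (hyz.2 u (h.trans (List.suffix_append y z)) h0 ?_)
    rintro rfl
    have := h.length_le
    simp only [List.length_append] at this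
    exact hy (List.length_eq_zero_iff.1 (by omega))
  · rcases eq_or_ne t [] with rfl | ht0
    · have hlt : x ++ y ++ z < y ++ z :=
        key y (List.suffix_append x y) hy (by simpa using Ne.symm hx)
      refine hlt.trans (hyz.2 _ (by simp) (by simpa using h0) ?_)
      simpa using Ne.symm hy
    · exact key t ht ht0 (by rintro rfl; exact h1 rfl)

theorem IsLongestLyndonAt.one {w : List α} (hw : IsLyndon w) : IsLongestLyndonAt w 1 w :=
  ⟨hw, by simp, fun v _ h => by simpa using h.length_le⟩

/-- A longest Lyndon word starting inside the left part of a standard factorization does not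
reach beyond it. -/
theorem IsLongestLyndonAt.of_left {w u v y : List α} (hf : IsStandardFactorization w u v)
    {j : ℕ} (hj : 0 < j) (hju : j < u.length) (h : IsLongestLyndonAt u (j + 1) y) :
    IsLongestLyndonAt w (j + 1) y := by
  obtain ⟨rfl, -, hv, hmax⟩ := hf
  obtain ⟨hy, hpre, hlong⟩ := h
  simp only [Nat.add_sub_cancel] at hpre hlong
  have hdrop : (u ++ v).drop j = u.drop j ++ v := List.drop_append_of_le_length hju.le
  refine ⟨hy, ?_, fun y' hy' hpre' => ?_⟩
  · rw [Nat.add_sub_cancel, hdrop]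
    exact hpre.trans (List.prefix_append _ _)
  rw [Nat.add_sub_cancel, hdrop] at hpre'
  rcases prefix_append_cases hpre' with h | ⟨t, rfl, ht⟩
  · exact hlong y' hy' h
  rcases eq_or_ne t [] with rfl | ht0
  · exact hlong _ hy' (by simp)
  exfalso
  obtain ⟨z, rfl⟩ := ht
  have hd : u.drop j ≠ [] := by simpa using hju
  -- The Lyndon words `u.drop j ++ t` and `v = t ++ z` overlap in `t`. The merged word is a suffix,
  -- proper because `0 < j` and longer than `v` because `j < u.length`.
  have hlyn := IsLyndon.append_of_overlap hd ht0 hy' hv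
  have hsuf : u.drop j ++ t ++ z <:+ u ++ (t ++ z) :=
    ⟨u.take j, by simp [← List.append_assoc]⟩
  have := hmax _ hsuf (fun e => by
    have := congrArg List.length e
    simp only [List.length_append, List.length_drop] at this
    omega) hlyn
  simp only [List.length_append, List.length_drop] at this
  omega

theorem IsLongestLyndonAt.of_right {u v y : List α} {j : ℕ} (hj : u.length ≤ j)
    (h : IsLongestLyndonAt v (j - u.length + 1) y) : IsLongestLyndonAt (u ++ v) (j + 1) y := by
  have : (u ++ v).drop j = v.drop (j - u.length) := by
    rw [List.drop_append, List.drop_eq_nil_of_le hj, List.nil_append]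
  simpa only [IsLongestLyndonAt, Nat.add_sub_cancel, this] using h

end Words

/-! ### Parse trees of straight-line programs -/

namespace SLP

variable {α : Type*} {G : SLP α}

/-- The length of the word derived by a variable. -/
def len (G : SLP α) (X : Fin G.numVars) : ℕ := (G.val X).length

theorem left_lt {X l r : Fin G.numVars} (h : G.rule X = .pair l r) : l < X :=
  G.acyclic X l (by rw [h]; exact Or.inl rfl)

theorem right_lt {X l r : Fin G.numVars} (h : G.rule X = .pair l r) : r < X :=
  G.acyclic X r (by rw [h]; exact Or.inr rfl)

theorem val_char {X : Fin G.numVars} {a : α} (h : G.rule X = .char a) : G.val X = [a] := by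
  rw [SLP.val]; split <;> simp_all

theorem val_pair {X l r : Fin G.numVars} (h : G.rule X = .pair l r) :
    G.val X = G.val l ++ G.val r := by
  rw [SLP.val]; split <;> simp_all

theorem len_char {X : Fin G.numVars} {a : α} (h : G.rule X = .char a) : G.len X = 1 := by
  simp [len, val_char h]

theorem len_pair {X l r : Fin G.numVars} (h : G.rule X = .pair l r) :
    G.len X = G.len l + G.len r := by
  simp [len, val_pair h]

/-- Induction along the rules. -/
theorem rule_induction {p : Fin G.numVars → Prop}
    (char : ∀ X a, G.rule X = .char a → p X)
    (pair : ∀ X l r, G.rule X = .pair l r → p l → p r → p X) (X : Fin G.numVars) : p X := by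
  induction X using WellFoundedLT.induction with
  | ind X ih =>
    cases h : G.rule X with
    | char a => exact char X a h
    | pair l r => exact pair X l r h (ih l (left_lt h)) (ih r (right_lt h))

theorem len_pos (X : Fin G.numVars) : 0 < G.len X := by
  induction X using rule_induction with
  | char X a h => rw [len_char h]; exact Nat.one_pos
  | pair X l r h hl hr => rw [len_pair h]; omega

/-- The number of nodes labeled `v` in the parse tree of `X`. -/
def occ (G : SLP α) (v X : Fin G.numVars) : ℕ :=
  (if X = v then 1 else 0) +
    match h : G.rule X with
    | .char _ => 0
    | .pair l r => G.occ v l + G.occ v r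
termination_by X.val
decreasing_by
  · exact left_lt h
  · exact right_lt h

/-- The highest node of the parse tree of `X` whose leftmost leaf has offset `j`. -/
def highest (G : SLP α) (X : Fin G.numVars) (j : ℕ) : Fin G.numVars :=
  if j = 0 then X else
    match h : G.rule X with
    | .char _ => X
    | .pair l r => if j < G.len l then G.highest l j else G.highest r (j - G.len l)
termination_by X.val
decreasing_by
  · exact left_lt h
  · exact right_lt h

/-- The parse tree of a variable, labeled by the derived words. -/
def tree (G : SLP α) (X : Fin G.numVars) : LTree α :=
  match h : G.rule X with
  | .char _ => .leaf (G.val X)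
  | .pair l r => .node (G.val X) (G.tree l) (G.tree r)
termination_by X.val
decreasing_by
  · exact left_lt h
  · exact right_lt h

theorem occ_char {v X : Fin G.numVars} {a : α} (h : G.rule X = .char a) :
    G.occ v X = if X = v then 1 else 0 := by
  rw [occ]; split <;> split <;> simp_all

theorem occ_pair {v X l r : Fin G.numVars} (h : G.rule X = .pair l r) :
    G.occ v X = (if X = v then 1 else 0) + (G.occ v l + G.occ v r) := by
  rw [occ]; split <;> split <;> simp_all

theorem highest_zero (X : Fin G.numVars) : G.highest X 0 = X := by
  rw [highest]; simp

theorem highest_left {X l r : Fin G.numVars} (h : G.rule X = .pair l r) {j : ℕ} (hj : 0 < j)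
    (hl : j < G.len l) : G.highest X j = G.highest l j := by
  rw [highest, if_neg hj.ne']; split <;> simp_all

theorem highest_right {X l r : Fin G.numVars} (h : G.rule X = .pair l r) (j : ℕ) :
    G.highest X (G.len l + j) = G.highest r j := by
  have := len_pos l
  rw [highest, if_neg (by omega)]; split <;> simp_all

theorem tree_char {X : Fin G.numVars} {a : α} (h : G.rule X = .char a) :
    G.tree X = .leaf (G.val X) := by
  rw [tree]; split <;> simp_all

theorem tree_pair {X l r : Fin G.numVars} (h : G.rule X = .pair l r) :
    G.tree X = .node (G.val X) (G.tree l) (G.tree r) := by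
  rw [tree]; split <;> simp_all

theorem tree_label (X : Fin G.numVars) : (G.tree X).label = G.val X := by
  cases h : G.rule X with
  | char a => rw [tree_char h]; rfl
  | pair l r => rw [tree_pair h]; rfl

/-! ### Highest nodes of the parse tree -/

theorem _root_.LyndonSLP.LTree.NodeAt.pos {t s : LTree α} {d i : ℕ} (h : t.NodeAt d i s) :
    0 < i := by
  induction h <;> omega

theorem nodeAt_le_len {X : Fin G.numVars} {d i : ℕ} {s : LTree α}
    (h : (G.tree X).NodeAt d i s) : i ≤ G.len X := by
  induction X using rule_induction generalizing d i s with
  | char X a hX =>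
    rw [tree_char hX] at h
    cases h
    exact len_pos X
  | pair X l r hX hl hr =>
    rw [tree_pair hX] at h
    rw [len_pair hX]
    cases h with
    | root => have := len_pos l; omega
    | left _ _ _ _ _ _ h => exact (hl h).trans (Nat.le_add_right _ _)
    | right _ _ _ _ _ i h =>
      rw [tree_label]
      exact Nat.add_le_add_left (hr h) _

/-- The root is the only candidate shared by the two subtrees: for `j > 0` every node whose leftmost
leaf is at `j` lies in the one subtree that contains that leaf. -/
theorem isHighestAt_tree (X : Fin G.numVars) (j : ℕ) (hj : j < G.len X) :
    (G.tree X).IsHighestAt (j + 1) (G.tree (G.highest X j)) := by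
  induction X using rule_induction generalizing j with
  | char X a hX =>
    obtain rfl : j = 0 := by rw [len_char hX] at hj; omega
    rw [highest_zero]
    exact ⟨0, .root _, fun _ _ _ => Nat.zero_le _⟩
  | pair X l r hX hl hr =>
    rcases Nat.eq_zero_or_pos j with rfl | hj0
    · rw [highest_zero]
      exact ⟨0, .root _, fun _ _ _ => Nat.zero_le _⟩
    rcases lt_or_ge j (G.len l) with hjl | hjl
    · obtain ⟨d, hd, hmin⟩ := hl j hjl
      rw [highest_left hX hj0 hjl, tree_pair hX]
      refine ⟨d + 1, .left _ _ _ _ _ _ hd, fun d' s' h => ?_⟩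
      generalize hi : j + 1 = i at h
      cases h with
      | root => omega
      | left _ _ _ _ _ _ h => subst hi; exact Nat.succ_le_succ (hmin _ _ h)
      | right _ _ _ _ _ i h =>
        have := h.pos
        rw [tree_label] at hi
        simp only [len] at hjl
        omega
    · obtain ⟨q, rfl⟩ := Nat.exists_eq_add_of_le hjl
      obtain ⟨d, hd, hmin⟩ := hr q (by rw [len_pair hX] at hj; omega)
      rw [highest_right hX, tree_pair hX]
      refine ⟨d + 1, ?_, fun d' s' h => ?_⟩
      · have := LTree.NodeAt.right (G.val X) (G.tree l) _ _ _ _ hd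
        rwa [tree_label] at this
      generalize hi : G.len l + q + 1 = i at h
      cases h with
      | root => omega
      | left _ _ _ _ _ _ h => have := nodeAt_le_len h; omega
      | right _ _ _ _ _ i h =>
        rw [tree_label] at hi
        simp only [len] at hi
        obtain rfl : i = q + 1 := by omega
        exact Nat.succ_le_succ (hmin _ _ h)

/-! ### Parse trees of Lyndon SLPs -/

variable [LinearOrder α] {T : List α}

theorem IsLyndonSLPOf.isLyndonTree (hG : G.IsLyndonSLPOf T) (X : Fin G.numVars) :
    IsLyndonTree (G.val X) (G.tree X) := by
  induction X using rule_induction with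
  | char X a h => rw [tree_char h, val_char h]; exact .single a
  | pair X l r h hl hr =>
    rw [tree_pair h]
    refine .split _ _ _ _ _ (hG.lyndon X) ?_ (hG.standard X l r h) hl hr
    have := len_pair h
    have := len_pos l
    have := len_pos r
    simp only [len] at *
    omega

theorem IsLyndonSLPOf.isLongestLyndonAt (hG : G.IsLyndonSLPOf T) (X : Fin G.numVars) (j : ℕ)
    (hj : j < G.len X) : IsLongestLyndonAt (G.val X) (j + 1) (G.val (G.highest X j)) := by
  induction X using rule_induction generalizing j with
  | char X a h =>
    obtain rfl : j = 0 := by rw [len_char h] at hj; omega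
    rw [highest_zero]
    exact .one (hG.lyndon X)
  | pair X l r h hl hr =>
    rcases Nat.eq_zero_or_pos j with rfl | hj0
    · rw [highest_zero]
      exact .one (hG.lyndon X)
    rcases lt_or_ge j (G.len l) with hjl | hjl
    · rw [highest_left h hj0 hjl]
      exact .of_left (hG.standard X l r h) hj0 hjl (hl j hjl)
    · obtain ⟨q, rfl⟩ := Nat.exists_eq_add_of_le hjl
      rw [highest_right h, val_pair h]
      refine .of_right hjl ?_
      have := hr q (by rw [len_pair h] at hj; omega)
      simpa [len] using this

end SLP

/-! ### The symmetric centroid decomposition -/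

namespace SLP

variable {α : Type*} {G : SLP α}

/-! ### Counting occurrences of variables in parse trees -/

theorem occ_eq_zero {v : Fin G.numVars} (X : Fin G.numVars) (h : X < v) : G.occ v X = 0 := by
  induction X using rule_induction with
  | char X a hX => rw [occ_char hX, if_neg h.ne]
  | pair X l r hX hl hr =>
    rw [occ_pair hX, if_neg h.ne, hl ((left_lt hX).trans h), hr ((right_lt hX).trans h)]

theorem occ_self_pos (v : Fin G.numVars) : 0 < G.occ v v := by
  cases h : G.rule v with
  | char a => simp [occ_char h]
  | pair l r => rw [occ_pair h, if_pos rfl]; omega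

/-- Occurrences of a variable in a parse tree cover disjoint parts of the word. -/
theorem occ_mul_len_le (v X : Fin G.numVars) : G.occ v X * G.len v ≤ G.len X := by
  induction X using rule_induction with
  | char X a h =>
    rw [occ_char h]
    split
    · subst v; simp
    · simp
  | pair X l r h hl hr =>
    rw [occ_pair h]
    split
    -- By acyclicity a variable does not recur below its own node.
    · subst v
      simp [occ_eq_zero l (left_lt h), occ_eq_zero r (right_lt h)]
    · rw [Nat.zero_add, Nat.add_mul, len_pair h]
      exact Nat.add_le_add hl hr

/-- Each node labeled by a member of `S` has a child labeled `v`, and distinct nodes have distinct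
children. -/
theorem sum_occ_le_of_uses {S : Finset (Fin G.numVars)} {v : Fin G.numVars}
    (hS : ∀ u ∈ S, (G.rule u).Uses v) (X : Fin G.numVars) :
    ∑ u ∈ S, G.occ u X ≤ G.occ v X := by
  have hv : ∑ u ∈ S, G.occ u v = 0 :=
    Finset.sum_eq_zero fun u hu => occ_eq_zero v (G.acyclic u v (hS u hu))
  have hv' := occ_self_pos v
  induction X using rule_induction with
  | char X a h =>
    have : ∑ u ∈ S, G.occ u X = 0 := Finset.sum_eq_zero fun u hu => by
      rw [occ_char h, if_neg]
      rintro rfl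
      have := hS _ hu
      rw [h] at this
      exact this
    omega
  | pair X l r h hl hr =>
    simp only [occ_pair h, Finset.sum_add_distrib, Finset.sum_ite_eq]
    split
    -- The root counts one on the left-hand side. It is paid for by a child equal to `v`, which
    -- contributes at least one on the right and, by `hv`, nothing on the left.
    · next hX =>
      have := hS X hX
      rw [h] at this
      rcases this with rfl | rfl <;> omega
    · omega

/-- A full binary tree with `m` leaves has `2m - 1` nodes. -/
theorem sum_occ (X : Fin G.numVars) : ∑ v, G.occ v X + 1 = 2 * G.len X := by
  induction X using rule_induction with
  | char X a h => simp [occ_char h, len_char h]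
  | pair X l r h hl hr =>
    simp only [occ_pair h, Finset.sum_add_distrib, Finset.sum_ite_eq, Finset.mem_univ, if_true,
      len_pair h]
    omega

variable (G) in
/-- The number of nodes labeled `v` in the parse tree of the whole word. -/
def mult (v : Fin G.numVars) : ℕ := G.occ v G.start

theorem mult_le_of_uses {u v : Fin G.numVars} (h : (G.rule u).Uses v) : G.mult u ≤ G.mult v := by
  simpa [mult] using sum_occ_le_of_uses (S := {u}) (v := v) (by simpa using h) G.start

theorem mult_add_le {u u' v : Fin G.numVars} (hne : u ≠ u') (h : (G.rule u).Uses v)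
    (h' : (G.rule u').Uses v) : G.mult u + G.mult u' ≤ G.mult v := by
  have := sum_occ_le_of_uses (S := {u, u'}) (v := v) (by simp [h, h']) G.start
  rwa [Finset.sum_pair hne] at this

/-- This is where reachability from the start symbol enters. -/
theorem mult_pos (v : Fin G.numVars) : 0 < G.mult v := by
  have := G.useful v
  induction this with
  | refl => exact occ_self_pos G.start
  | tail _ h ih => exact ih.trans_le (mult_le_of_uses h)

theorem mult_mul_len_le (v : Fin G.numVars) : G.mult v * G.len v ≤ G.len G.start :=
  occ_mul_len_le v G.start

theorem mult_le (v : Fin G.numVars) : G.mult v ≤ G.len G.start :=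
  (Nat.le_mul_of_pos_right _ (len_pos v)).trans (mult_mul_len_le v)

theorem len_le (v : Fin G.numVars) : G.len v ≤ G.len G.start :=
  (Nat.le_mul_of_pos_left _ (mult_pos v)).trans (mult_mul_len_le v)

/-- Every variable labels at least one node of the parse tree. The bound ensures that addresses and
variable indices fit into a machine word. -/
theorem numVars_le : G.numVars ≤ 2 * G.len G.start := by
  have h : ∑ _v : Fin G.numVars, 1 ≤ ∑ v, G.mult v := Finset.sum_le_sum fun v _ => mult_pos v
  have := sum_occ G.start
  simp only [Finset.sum_const, Finset.card_univ, Fintype.card_fin, smul_eq_mul, mul_one] at h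
  change ∑ v, G.mult v + 1 = _ at this
  omega

theorem numVars_le_size (G : SLP α) : G.numVars ≤ G.size := by
  have h : ∑ _v : Fin G.numVars, 1 ≤ G.size := Finset.sum_le_sum fun v _ => by
    cases G.rule v <;> simp [Rule.length]
  simpa using h

/-! ### Heavy edges, the potential, and heavy paths -/

variable (G) in
/-- The edge from `u` to its child `v` belongs to a path of the symmetric centroid
decomposition. -/
def Heavy (u v : Fin G.numVars) : Prop :=
  (G.rule u).Uses v ∧ Nat.log 2 (G.len v) = Nat.log 2 (G.len u) ∧
    Nat.log 2 (G.mult v) = Nat.log 2 (G.mult u)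

/-- Both summands are at least `2 ^ a`, so the sum is at least `2 ^ (a + 1)`. This doubling is what
makes heavy edges unique in both directions. -/
theorem _root_.Nat.log_two_lt_log_two_add {a b c : ℕ} (hb : 0 < b) (hc : 0 < c)
    (hac : Nat.log 2 b = a) (hbc : Nat.log 2 c = a) : a < Nat.log 2 (b + c) := by
  have h₁ := Nat.pow_log_le_self 2 hb.ne'
  have h₂ := Nat.pow_log_le_self 2 hc.ne'
  rw [hac] at h₁
  rw [hbc] at h₂
  exact Nat.le_log_of_pow_le Nat.one_lt_two (by rw [pow_succ]; omega)

theorem Heavy.lt {u v : Fin G.numVars} (h : G.Heavy u v) : v < u := G.acyclic u v h.1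

/-- Occurrences below distinct parents add up, so two heavy parents would double the multiplicity.
-/
theorem Heavy.parent_unique {u u' v : Fin G.numVars} (h : G.Heavy u v) (h' : G.Heavy u' v) :
    u = u' := by
  by_contra hne
  have h₁ := Nat.log_two_lt_log_two_add (mult_pos u) (mult_pos u') h.2.2.symm h'.2.2.symm
  have h₂ := Nat.log_mono_right (b := 2) (mult_add_le hne h.1 h'.1)
  omega

/-- The lengths of the children add up, so two heavy children would double the length. The case `l =
r` is included. -/
theorem not_heavy_right {u l r : Fin G.numVars} (hu : G.rule u = .pair l r)
    (h : G.Heavy u l) : ¬ G.Heavy u r := fun h' => by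
  have h₁ := Nat.log_two_lt_log_two_add (len_pos l) (len_pos r) h.2.1 h'.2.1
  rw [len_pair hu] at h₁
  omega

variable (G) in
/-- The potential that drops along the edges that are not heavy. -/
def pot (v : Fin G.numVars) : ℕ :=
  Nat.log 2 (G.len v) + (Nat.log 2 (G.len G.start) - Nat.log 2 (G.mult v))

theorem Heavy.pot_eq {u v : Fin G.numVars} (h : G.Heavy u v) : G.pot v = G.pot u := by
  rw [pot, pot, h.2.1, h.2.2]

/-- Along any edge the length does not grow and the multiplicity does not shrink; if the edge is not
heavy, one of the two logarithms changes. -/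
theorem pot_lt {u v : Fin G.numVars} (h : (G.rule u).Uses v) (hh : ¬ G.Heavy u v) :
    G.pot v < G.pot u := by
  have h₁ := Nat.log_mono_right (b := 2) (mult_le_of_uses h)
  have h₂ : Nat.log 2 (G.len v) ≤ Nat.log 2 (G.len u) := Nat.log_mono_right (by
    cases hu : G.rule u with
    | char a => rw [hu] at h; exact h.elim
    | pair l r =>
      rw [hu] at h
      rw [len_pair hu]
      rcases h with rfl | rfl <;> omega)
  -- This keeps the truncated subtraction in `pot` from hiding the drop.
  have h₃ := Nat.log_mono_right (b := 2) (mult_le v)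
  have h₄ : ¬ (Nat.log 2 (G.len v) = Nat.log 2 (G.len u) ∧
    Nat.log 2 (G.mult v) = Nat.log 2 (G.mult u)) := fun e => hh ⟨h, e⟩
  simp only [pot]
  omega

theorem pot_start_le (G : SLP α) : G.pot G.start ≤ 2 * Nat.log 2 (G.len G.start) := by
  simp only [pot]
  omega

open Classical in
variable (G) in
/-- The first variable of the heavy path through `v`. -/
noncomputable def top (v : Fin G.numVars) : Fin G.numVars :=
  if h : ∃ u, G.Heavy u v then top h.choose else v
termination_by G.numVars - v.val
decreasing_by
  have := h.choose_spec.lt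
  omega

theorem Heavy.top_eq {u v : Fin G.numVars} (h : G.Heavy u v) : G.top v = G.top u := by
  have hex : ∃ u, G.Heavy u v := ⟨u, h⟩
  rw [top, dif_pos hex, hex.choose_spec.parent_unique h]

theorem top_eq_self {v : Fin G.numVars} (h : ¬ ∃ u, G.Heavy u v) : G.top v = v := by
  rw [top, dif_neg h]

/-- Induction downwards along the heavy paths. -/
theorem heavy_induction {p : Fin G.numVars → Prop}
    (first : ∀ v, G.top v = v → p v)
    (next : ∀ u v, G.Heavy u v → p u → p v) (v : Fin G.numVars) : p v := by
  induction v using WellFoundedGT.induction with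
  | ind v ih =>
    by_cases h : ∃ u, G.Heavy u v
    · obtain ⟨u, hu⟩ := h
      exact next u v hu (ih u hu.lt)
    · exact first v (top_eq_self h)

theorem top_top (v : Fin G.numVars) : G.top (G.top v) = G.top v := by
  induction v using heavy_induction with
  | first v h => rw [h, h]
  | next u v h ih => rw [h.top_eq, ih]

theorem pot_top (v : Fin G.numVars) : G.pot (G.top v) = G.pot v := by
  induction v using heavy_induction with
  | first v h => rw [h]
  | next u v h ih => rw [h.top_eq, ih, h.pot_eq]

/-- Moving up to the top of a path does not change the logarithm of the length, so the search costs
of successive paths telescope. -/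
theorem log_len_top (v : Fin G.numVars) :
    Nat.log 2 (G.len (G.top v)) = Nat.log 2 (G.len v) := by
  induction v using heavy_induction with
  | first v h => rw [h]
  | next u v h ih => rw [h.top_eq, ih, h.2.1]

theorem top_start (G : SLP α) : G.top G.start = G.start :=
  top_eq_self fun ⟨u, hu⟩ => by
    have := hu.lt
    have h₂ := u.isLt
    simp only [Fin.lt_def, start] at this
    omega

/-- Here `o` locates an occurrence of `v` below the top of its path. The offset `j = 0` is excluded:
there the highest node may be a proper ancestor of `v`. -/
theorem exists_offset (v : Fin G.numVars) : ∃ o, o + G.len v ≤ G.len (G.top v) ∧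
    ∀ j, 0 < j → j < G.len v → G.highest (G.top v) (o + j) = G.highest v j := by
  induction v using heavy_induction with
  | first v h => exact ⟨0, by simp [h], fun j _ _ => by rw [h, Nat.zero_add]⟩
  | next u v h ih =>
    obtain ⟨o, ho, hj⟩ := ih
    rw [h.top_eq]
    have hu := h.1
    cases hr : G.rule u with
    | char a => rw [hr] at hu; exact hu.elim
    | pair l r =>
      rw [hr] at hu
      rw [len_pair hr] at ho hj
      rcases hu with rfl | rfl
      · refine ⟨o, by omega, fun j h0 h1 => ?_⟩
        rw [hj j h0 (by omega), highest_left hr h0 h1]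
      · refine ⟨o + G.len l, by omega, fun j h0 h1 => ?_⟩
        rw [Nat.add_assoc, hj _ (by omega) (by omega), highest_right hr]

end SLP

/-! ### Partitions of an interval into segments -/

/-- A segment `[start, start + len)`, identified by a number. -/
structure Seg where
  id : ℕ
  start : ℕ
  len : ℕ

/-- The list of segments is a partition of `[b, e)`, from left to right. -/
def Contig (b e : ℕ) : List Seg → Prop
  | [] => b = e
  | σ :: L => σ.start = b ∧ Contig (b + σ.len) e L

theorem Contig.append {b m e : ℕ} {L₁ L₂ : List Seg} (h₁ : Contig b m L₁) (h₂ : Contig m e L₂) :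
    Contig b e (L₁ ++ L₂) := by
  induction L₁ generalizing b with
  | nil => cases h₁; exact h₂
  | cons σ L ih => exact ⟨h₁.1, ih h₁.2⟩

theorem Contig.le {b e : ℕ} {L : List Seg} (h : Contig b e L) : b ≤ e := by
  induction L generalizing b with
  | nil => exact Nat.le_of_eq h
  | cons σ L ih => exact (Nat.le_add_right _ _).trans (ih h.2)

theorem Contig.mem {b e : ℕ} {L : List Seg} (h : Contig b e L) {σ : Seg} (hσ : σ ∈ L) :
    b ≤ σ.start ∧ σ.start + σ.len ≤ e := by
  induction L generalizing b with
  | nil => simp at hσ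
  | cons τ L ih =>
    rcases List.mem_cons.1 hσ with rfl | hσ
    · exact ⟨h.1.ge, h.1 ▸ h.2.le⟩
    · have := ih h.2 hσ
      omega

theorem Contig.exists_split {b e p : ℕ} {L : List Seg} (h : Contig b e L) (hb : b ≤ p)
    (he : p < e) : ∃ L₁ σ L₂, L = L₁ ++ σ :: L₂ ∧ Contig b σ.start L₁ ∧
      Contig (σ.start + σ.len) e L₂ ∧ σ.start ≤ p ∧ p < σ.start + σ.len := by
  induction L generalizing b with
  | nil => cases h; omega
  | cons τ L ih =>
    obtain ⟨rfl, h⟩ := h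
    rcases lt_or_ge p (τ.start + τ.len) with hp | hp
    · exact ⟨[], τ, L, rfl, rfl, h, hb, hp⟩
    · obtain ⟨L₁, σ, L₂, rfl, h₁, h₂, h₃⟩ := ih h hp
      exact ⟨τ :: L₁, σ, L₂, rfl, ⟨rfl, h₁⟩, h₂, h₃⟩

namespace SLP

variable {α : Type*} {G : SLP α}

/-- The subtrees hanging off a heavy path partition the word derived by its first variable. The
segment with the number `2 * u` or `2 * u + 1` belongs to the left or right child of `u`. -/
theorem exists_segments (v : Fin G.numVars) (t : Fin G.numVars) (b : ℕ)
    (ht : ∀ j, 0 < j → j < G.len v → G.highest t (b + j) = G.highest v j) :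
    ∃ L : List Seg, Contig b (b + G.len v) L ∧ (L.map Seg.id).Nodup ∧
      (∀ σ ∈ L, 0 < σ.len) ∧
      (∀ σ ∈ L, ∃ u : Fin G.numVars, u ≤ v ∧ G.top u = G.top v ∧ σ.id / 2 = u.val) ∧
      ∀ σ ∈ L, 1 < σ.len → ∃ c : Fin G.numVars, G.len c = σ.len ∧ G.pot c < G.pot v ∧
        ∀ j, 0 < j → j < σ.len → G.highest t (σ.start + j) = G.highest c j := by
  induction v using rule_induction generalizing b with
  | char v a h =>
    -- A path ending in a character keeps that leaf as a segment of length 1. Its only position is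
    -- its start, so no child is needed to descend into.
    refine ⟨[⟨2 * v, b, 1⟩], by simp [Contig, len_char h], by simp, by simp, ?_, by simp⟩
    simpa using ⟨v, le_rfl, rfl, rfl⟩
  | pair v l r h hl hr =>
    have hlv := left_lt h
    have hrv := right_lt h
    have hul : (G.rule v).Uses l := by rw [h]; exact Or.inl rfl
    have hur : (G.rule v).Uses r := by rw [h]; exact Or.inr rfl
    have htl : ∀ j, 0 < j → j < G.len l → G.highest t (b + j) = G.highest l j :=
      fun j h0 h1 => by rw [ht j h0 (by rw [len_pair h]; omega), highest_left h h0 h1]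
    have htr : ∀ j, 0 < j → j < G.len r → G.highest t (b + G.len l + j) = G.highest r j :=
      fun j h0 h1 => by
        rw [Nat.add_assoc, ht _ (by omega) (by rw [len_pair h]; omega), highest_right h]
    have hidl : ∃ u : Fin G.numVars, u ≤ v ∧ G.top u = G.top v ∧ (2 * v.val) / 2 = u.val :=
      ⟨v, le_rfl, rfl, by omega⟩
    have hidr : ∃ u : Fin G.numVars, u ≤ v ∧ G.top u = G.top v ∧ (2 * v.val + 1) / 2 = u.val :=
      ⟨v, le_rfl, rfl, by omega⟩
    by_cases hhl : G.Heavy v l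
    · obtain ⟨L, h₁, h₂, h₃, h₄, h₅⟩ := hl b htl
      refine ⟨L ++ [⟨2 * v + 1, b + G.len l, G.len r⟩], h₁.append ?_, ?_, ?_, ?_, ?_⟩
      · simp [Contig, len_pair h, Nat.add_assoc]
      · simp only [List.map_append, List.map_cons, List.map_nil]
        refine List.Nodup.append h₂ (by simp) ?_
        simp only [List.disjoint_singleton, List.mem_map, not_exists, not_and]
        intro σ hσ e
        -- The earlier numbers belong to variables `u ≤ l < v`, so the new number is fresh.
        obtain ⟨u, hu, -, hid⟩ := h₄ σ hσ
        have : u.val < v.val := lt_of_le_of_lt hu hlv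
        omega
      · simp only [List.forall_mem_append, List.forall_mem_singleton]
        exact ⟨h₃, len_pos r⟩
      · simp only [List.forall_mem_append, List.forall_mem_singleton]
        refine ⟨fun σ hσ => ?_, hidr⟩
        obtain ⟨u, hu, htop, hid⟩ := h₄ σ hσ
        exact ⟨u, hu.trans hlv.le, htop.trans hhl.top_eq, hid⟩
      · simp only [List.forall_mem_append, List.forall_mem_singleton]
        refine ⟨fun σ hσ h1 => ?_, fun _ => ⟨r, rfl, pot_lt hur (not_heavy_right h hhl), htr⟩⟩
        rw [← hhl.pot_eq]
        exact h₅ σ hσ h1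
    by_cases hhr : G.Heavy v r
    · obtain ⟨L, h₁, h₂, h₃, h₄, h₅⟩ := hr (b + G.len l) htr
      refine ⟨⟨2 * v, b, G.len l⟩ :: L, ⟨rfl, ?_⟩, ?_, ?_, ?_, ?_⟩
      · rw [len_pair h, ← Nat.add_assoc]; exact h₁
      · simp only [List.map_cons, List.nodup_cons]
        refine ⟨?_, h₂⟩
        simp only [List.mem_map, not_exists, not_and]
        intro σ hσ e
        obtain ⟨u, hu, -, hid⟩ := h₄ σ hσ
        have : u.val < v.val := lt_of_le_of_lt hu hrv
        omega
      · simp only [List.forall_mem_cons]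
        exact ⟨len_pos l, h₃⟩
      · simp only [List.forall_mem_cons]
        refine ⟨hidl, fun σ hσ => ?_⟩
        obtain ⟨u, hu, htop, hid⟩ := h₄ σ hσ
        exact ⟨u, hu.trans hrv.le, htop.trans hhr.top_eq, hid⟩
      · simp only [List.forall_mem_cons]
        refine ⟨fun _ => ⟨l, rfl, pot_lt hul hhl, htl⟩, fun σ hσ h1 => ?_⟩
        rw [← hhr.pot_eq]
        exact h₅ σ hσ h1
    · refine ⟨[⟨2 * v, b, G.len l⟩, ⟨2 * v + 1, b + G.len l, G.len r⟩], ?_, ?_, ?_, ?_, ?_⟩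
      · simp [Contig, len_pair h, Nat.add_assoc]
      · simp
      · rw [List.forall_mem_cons, List.forall_mem_singleton]
        exact ⟨len_pos l, len_pos r⟩
      · rw [List.forall_mem_cons, List.forall_mem_singleton]
        exact ⟨hidl, hidr⟩
      · rw [List.forall_mem_cons, List.forall_mem_singleton]
        exact ⟨fun _ => ⟨l, rfl, pot_lt hul hhl, htl⟩, fun _ => ⟨r, rfl, pot_lt hur hhr, htr⟩⟩

end SLP

/-! ### Navigation structures -/

/-- A linked structure of ternary search nodes. The node `x` handles the interval
`[key x, lim x)`; positions outside of it are passed on to `left x` and `right x`, the position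
`key x` is answered by `ansLen x` and `ansIdx x`, and the other positions of the interval are passed
on to `target x`, where `key x` becomes `off x`. -/
structure Nav where
  key : ℕ → ℕ
  lim : ℕ → ℕ
  left : ℕ → ℕ
  right : ℕ → ℕ
  off : ℕ → ℕ
  target : ℕ → ℕ
  ansLen : ℕ → ℕ
  ansIdx : ℕ → ℕ

/-- `N.Run K B m x p y`: the search for the position `p` that starts at the node `x` ends at the
node `y` after `m` moves; the visited nodes are below `K` and the positions are at most `B`. -/
inductive Nav.Run (N : Nav) (K B : ℕ) : ℕ → ℕ → ℕ → ℕ → Prop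
  | done (x p : ℕ) (hx : x < K) (hp : p ≤ B) (h : p = N.key x) : Run N K B 0 x p x
  | left (m x p y : ℕ) (hx : x < K) (hB : N.key x ≤ B) (h : p < N.key x)
      (hr : Run N K B m (N.left x) p y) : Run N K B (m + 1) x p y
  | right (m x p y : ℕ) (hx : x < K) (hp : p ≤ B) (hk : N.key x < p) (h : N.lim x ≤ p)
      (hr : Run N K B m (N.right x) p y) : Run N K B (m + 1) x p y
  | into (m x p y : ℕ) (hx : x < K) (hB : N.lim x ≤ B) (hk : N.key x < p) (h : p < N.lim x)
      (hr : Run N K B m (N.target x) (p - N.key x + N.off x) y) : Run N K B (m + 1) x p y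

/-- A partition of `[b, e)` has a search tree, with one node for each segment, in which a segment
of length `ℓ` has depth at most `log (e - b) - log ℓ`. -/
theorem exists_searchTree {K B : ℕ} (n : ℕ) (L : List Seg) (hn : L.length ≤ n) (b e : ℕ)
    (hL : Contig b e L) (hnd : (L.map Seg.id).Nodup) (hpos : ∀ σ ∈ L, 0 < σ.len)
    (hK : ∀ σ ∈ L, σ.id < K) (hB : e ≤ B) :
    ∃ (root : ℕ) (left right : ℕ → ℕ) (seg : ℕ → Seg), (∀ σ ∈ L, seg σ.id = σ) ∧
      ∀ N : Nav, (∀ σ ∈ L, N.key σ.id = σ.start ∧ N.lim σ.id = σ.start + σ.len ∧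
          N.left σ.id = left σ.id ∧ N.right σ.id = right σ.id) →
        ∀ σ ∈ L, ∀ p, σ.start ≤ p → p < σ.start + σ.len → ∀ m y, N.Run K B m σ.id p y →
          ∃ m', m' + Nat.log 2 σ.len ≤ m + Nat.log 2 (e - b) ∧ N.Run K B m' root p y := by
  induction n generalizing L b e with
  | zero =>
    obtain rfl : L = [] := List.length_eq_zero_iff.1 (by omega)
    -- An empty subtree gets an arbitrary root, since no search for a position in a segment enters
    -- it.
    exact ⟨0, id, id, fun _ => ⟨0, 0, 0⟩, by simp, by simp⟩
  | succ n ih =>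
    rcases eq_or_ne L [] with rfl | hne
    · exact ⟨0, id, id, fun _ => ⟨0, 0, 0⟩, by simp, by simp⟩
    have hbe : b < e := by
      obtain ⟨σ, hσ⟩ := List.exists_mem_of_ne_nil L hne
      have := hL.mem hσ
      have := hpos σ hσ
      omega
    -- The root is the segment that covers the midpoint. What remains on either side has at most
    -- half the length, so one move is paid for by a drop of the logarithm.
    obtain ⟨L₁, τ, L₂, rfl, h₁, h₂, hτ, hτ'⟩ :=
      hL.exists_split (p := (b + e) / 2) (by omega) (by omega)
    have hdouble : ∀ d, 0 < d → 2 * d ≤ e - b → Nat.log 2 d + 1 ≤ Nat.log 2 (e - b) := by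
      intro d hd h
      rw [← Nat.log_mul_base Nat.one_lt_two hd.ne']
      exact Nat.log_mono_right (by omega)
    simp only [List.map_append, List.map_cons, List.nodup_append, List.nodup_cons,
      List.mem_map, List.mem_cons, not_exists, not_and] at hnd
    obtain ⟨hnd₁, ⟨hτ₂, hnd₂⟩, hdis⟩ := hnd
    have hτ₁ : ∀ σ ∈ L₁, σ.id ≠ τ.id := fun σ hσ => hdis _ ⟨σ, hσ, rfl⟩ _ (Or.inl rfl)
    have h₁₂ : ∀ σ ∈ L₂, σ.id ∉ L₁.map Seg.id := by
      intro σ hσ hmem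
      rw [List.mem_map] at hmem
      exact hdis _ hmem _ (Or.inr ⟨σ, hσ, rfl⟩) rfl
    simp only [List.forall_mem_append, List.forall_mem_cons] at hpos hK
    simp only [List.length_append, List.length_cons] at hn
    obtain ⟨root₁, left₁, right₁, seg₁, hs₁, H₁⟩ := ih L₁ (by omega) _ _ h₁ hnd₁ hpos.1 hK.1
      (by have := h₂.le; omega)
    obtain ⟨root₂, left₂, right₂, seg₂, hs₂, H₂⟩ := ih L₂ (by omega) _ _ h₂ hnd₂ hpos.2.2 hK.2.2 hB
    refine ⟨τ.id,
      fun x => if x = τ.id then root₁ else if x ∈ L₁.map Seg.id then left₁ x else left₂ x,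
      fun x => if x = τ.id then root₂ else if x ∈ L₁.map Seg.id then right₁ x else right₂ x,
      fun x => if x = τ.id then τ else if x ∈ L₁.map Seg.id then seg₁ x else seg₂ x, ?_, ?_⟩
    · simp only [List.forall_mem_append, List.forall_mem_cons]
      refine ⟨fun σ hσ => ?_, by simp, fun σ hσ => ?_⟩
      · rw [if_neg (hτ₁ σ hσ), if_pos (List.mem_map_of_mem hσ), hs₁ σ hσ]
      · rw [if_neg (hτ₂ σ hσ), if_neg (h₁₂ σ hσ), hs₂ σ hσ]
    intro N hN
    simp only [List.forall_mem_append, List.forall_mem_cons] at hN ⊢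
    obtain ⟨hN₁, ⟨hkey, hlim, hleft, hright⟩, hN₂⟩ := hN
    rw [if_pos trivial] at hleft hright
    have hτe := h₂.le
    refine ⟨fun σ hσ p hp hp' m y hr => ?_, fun p hp hp' m y hr => ?_,
      fun σ hσ p hp hp' m y hr => ?_⟩
    · obtain ⟨m', hm', hr'⟩ := H₁ N (fun ρ hρ => by
        have := hN₁ ρ hρ
        rwa [if_neg (hτ₁ ρ hρ), if_pos (List.mem_map_of_mem hρ), if_neg (hτ₁ ρ hρ),
          if_pos (List.mem_map_of_mem hρ)] at this) σ hσ p hp hp' m y hr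
      have hmem := h₁.mem hσ
      have := hdouble (τ.start - b) (by omega) (by omega)
      refine ⟨m' + 1, by omega, .left _ _ _ _ hK.2.1 (by omega) (by omega) ?_⟩
      rwa [hleft]
    · refine ⟨m, Nat.add_le_add_left (Nat.log_mono_right ?_) _, hr⟩
      have := h₁.le
      omega
    · obtain ⟨m', hm', hr'⟩ := H₂ N (fun ρ hρ => by
        have := hN₂ ρ hρ
        rwa [if_neg (hτ₂ ρ hρ), if_neg (h₁₂ ρ hρ), if_neg (hτ₂ ρ hρ),
          if_neg (h₁₂ ρ hρ)] at this) σ hσ p hp hp' m y hr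
      have hmem := h₂.mem hσ
      have := hdouble (e - (τ.start + τ.len)) (by omega) (by omega)
      have := hpos.2.1
      refine ⟨m' + 1, by omega, .right _ _ _ _ hK.2.1 (by omega) (by omega) (by omega) ?_⟩
      rwa [hright]

namespace SLP

variable {α : Type*} (G : SLP α)

/-- A straight-line program with `k` variables has a navigation structure of `2 * k` nodes that
finds the highest nodes of the parse tree in a logarithmic number of moves. -/
theorem exists_nav : ∃ (N : Nav) (root : ℕ), ∀ p < G.len G.start,
    ∃ m y, m ≤ 3 * Nat.log 2 (G.len G.start) ∧
      N.Run (2 * G.numVars) (G.len G.start) m root p y ∧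
      N.ansLen y = G.len (G.highest G.start p) ∧ N.ansIdx y = (G.highest G.start p).val := by
  classical
  have hseg := fun v : Fin G.numVars =>
    exists_segments v v 0 (fun j _ _ => by rw [Nat.zero_add])
  choose L hC hnd hpos hid hlight using hseg
  have hids : ∀ v, ∀ σ ∈ L v, σ.id < 2 * G.numVars := fun v σ hσ => by
    obtain ⟨u, -, -, h⟩ := hid v σ hσ
    have := u.isLt
    omega
  choose root left right seg hsg hrun using fun v : Fin G.numVars =>
    exists_searchTree (K := 2 * G.numVars) (B := G.len G.start) _ (L v) le_rfl _ _ (hC v) (hnd v)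
      (hpos v) (hids v) (by have := len_le v; omega)
  choose off hoff hhigh using fun v : Fin G.numVars => exists_offset v
  -- Node `x` belongs to the path through the variable `x / 2`, so the search trees of all paths
  -- share one array without collisions. The value `G.start` is only a default.
  let path : ℕ → Fin G.numVars := fun x =>
    if h : x / 2 < G.numVars then G.top ⟨x / 2, h⟩ else G.start
  let sg : ℕ → Seg := fun x => seg (path x) x
  have hpath : ∀ t, G.top t = t → ∀ σ ∈ L t, path σ.id = t := by
    intro t ht σ hσ
    obtain ⟨u, -, htop, h⟩ := hid t σ hσ
    have h' : σ.id / 2 < G.numVars := h ▸ u.isLt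
    simp only [path, dif_pos h']
    rw [show (⟨σ.id / 2, h'⟩ : Fin G.numVars) = u from Fin.ext h, htop, ht]
  -- The conditions move under the existential so that `child` becomes a total function; its value
  -- is irrelevant where they fail.
  have hex : ∀ x, ∃ c : Fin G.numVars, 1 < (sg x).len → sg x ∈ L (path x) →
      G.len c = (sg x).len ∧ G.pot c < G.pot (path x) ∧ ∀ j, 0 < j → j < (sg x).len →
        G.highest (path x) ((sg x).start + j) = G.highest c j := by
    intro x
    by_cases h : 1 < (sg x).len ∧ sg x ∈ L (path x)
    · obtain ⟨c, hc⟩ := hlight _ _ h.2 h.1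
      exact ⟨c, fun _ _ => hc⟩
    · exact ⟨G.start, fun h1 h2 => absurd ⟨h1, h2⟩ h⟩
  choose child hchild using hex
  let N : Nav :=
    { key := fun x => (sg x).start
      lim := fun x => (sg x).start + (sg x).len
      left := fun x => left (path x) x
      right := fun x => right (path x) x
      off := fun x => off (child x)
      target := fun x => root (G.top (child x))
      ansLen := fun x => G.len (G.highest (path x) (sg x).start)
      ansIdx := fun x => (G.highest (path x) (sg x).start).val }
  -- The budget combines the search within paths, `log (len t)`, with one move for each change of
  -- path, bounded by the potential.
  have main : ∀ (n : ℕ) (t : Fin G.numVars), G.pot t = n → G.top t = t → ∀ p < G.len t,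
      ∃ m y, m ≤ Nat.log 2 (G.len t) + n ∧
        N.Run (2 * G.numVars) (G.len G.start) m (root t) p y ∧
        N.ansLen y = G.len (G.highest t p) ∧ N.ansIdx y = (G.highest t p).val := by
    intro n
    induction n using Nat.strong_induction_on with
    | _ n ih =>
      intro t hn ht p hp
      have hsgt : ∀ σ ∈ L t, sg σ.id = σ := fun σ hσ => by
        simp only [sg, hpath t ht σ hσ, hsg t σ hσ]
      obtain ⟨L₁, σ, L₂, hL, -, -, hσp, hpσ⟩ :=
        (hC t).exists_split (p := p) (Nat.zero_le _) (by omega)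
      have hσ : σ ∈ L t := by rw [hL]; simp
      have hpt := hpath t ht σ hσ
      have hst := hsgt σ hσ
      have hlen := len_le t
      have hbound := (hC t).mem hσ
      have key := hrun t N (fun ρ hρ => by
        simp only [N, hsgt ρ hρ, hpath t ht ρ hρ, and_self]) σ hσ p hσp hpσ
      simp only [Nat.zero_add, Nat.sub_zero] at key hbound
      have hlogσ : Nat.log 2 σ.len ≤ Nat.log 2 (G.len t) := Nat.log_mono_right (by omega)
      rcases hσp.eq_or_lt with rfl | hlt
      · obtain ⟨m, hm, hr⟩ := key 0 σ.id
          (.done _ _ (hids t σ hσ) (by omega) (by simp only [N, hst]))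
        exact ⟨m, σ.id, by omega, hr, by simp only [N, hst, hpt], by simp only [N, hst, hpt]⟩
      · have hc := hchild σ.id
        rw [hst, hpt] at hc
        obtain ⟨hclen, hcpot, hchigh⟩ := hc (by omega) hσ
        have ho := hoff (child σ.id)
        obtain ⟨m, y, hm, hr, h₁, h₂⟩ := ih (G.pot (child σ.id)) (by omega)
          (G.top (child σ.id)) (pot_top _) (top_top _) (p - σ.start + off (child σ.id)) (by omega)
        have hh : G.highest (G.top (child σ.id)) (p - σ.start + off (child σ.id)) =
            G.highest t p := by
          rw [Nat.add_comm, hhigh _ _ (by omega) (by omega), ← hchigh _ (by omega) (by omega)]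
          congr 1
          omega
        -- The rest of the search costs at most `log σ.len + pot c`. Reaching `σ` costs at most `log
        -- (len t) - log σ.len`, and the move into `c` is paid for by `pot c < n`.
        rw [log_len_top, hclen] at hm
        obtain ⟨m', hm', hr'⟩ := key (m + 1) y
          (.into _ _ _ _ (hids t σ hσ) (by simp only [N, hst]; omega)
            (by simpa only [N, hst] using hlt) (by simpa only [N, hst] using hpσ)
            (by simpa only [N, hst] using hr))
        exact ⟨m', y, by omega, hr', by rw [h₁, hh], by rw [h₂, hh]⟩
  refine ⟨N, root G.start, fun p hp => ?_⟩
  obtain ⟨m, y, hm, h⟩ := main _ G.start rfl (top_start G) p hp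
  exact ⟨m, y, by have := pot_start_le G; omega, h⟩

end SLP

/-! ### The query program -/

section Execution

variable {w : ℕ} {P : List Instr} {pc t d a b l c : ℕ} {reg : ℕ → BitVec w}
  {mem : BitVec w → BitVec w} {s' : Config w}

theorem HaltsIn.const (v : BitVec w) (hP : P[pc]? = some (.const d c)) (hv : BitVec.ofNat w c = v)
    (H : HaltsIn P t ⟨pc + 1, Function.update reg d v, mem⟩ s') :
    HaltsIn P (t + 1) ⟨pc, reg, mem⟩ s' :=
  .next _ _ _ _ (by simp [step, hP, Instr.exec, hv]) H

theorem HaltsIn.op {o : Op} (v : BitVec w) (hP : P[pc]? = some (.op o d a b))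
    (hv : o.eval (reg a) (reg b) = v)
    (H : HaltsIn P t ⟨pc + 1, Function.update reg d v, mem⟩ s') :
    HaltsIn P (t + 1) ⟨pc, reg, mem⟩ s' :=
  .next _ _ _ _ (by simp [step, hP, Instr.exec, hv]) H

theorem HaltsIn.load (v : BitVec w) (hP : P[pc]? = some (.load d a)) (hv : mem (reg a) = v)
    (H : HaltsIn P t ⟨pc + 1, Function.update reg d v, mem⟩ s') :
    HaltsIn P (t + 1) ⟨pc, reg, mem⟩ s' :=
  .next _ _ _ _ (by simp [step, hP, Instr.exec, hv]) H

theorem HaltsIn.jmp (hP : P[pc]? = some (.jmp l)) (H : HaltsIn P t ⟨l, reg, mem⟩ s') :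
    HaltsIn P (t + 1) ⟨pc, reg, mem⟩ s' :=
  .next _ _ _ _ (by simp [step, hP, Instr.exec]) H

theorem HaltsIn.jeq_pos (hP : P[pc]? = some (.jeq a b l)) (h : reg a = reg b)
    (H : HaltsIn P t ⟨l, reg, mem⟩ s') : HaltsIn P (t + 1) ⟨pc, reg, mem⟩ s' :=
  .next _ _ _ _ (by simp [step, hP, Instr.exec, h]) H

theorem HaltsIn.jeq_neg (hP : P[pc]? = some (.jeq a b l)) (h : reg a ≠ reg b)
    (H : HaltsIn P t ⟨pc + 1, reg, mem⟩ s') : HaltsIn P (t + 1) ⟨pc, reg, mem⟩ s' :=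
  .next _ _ _ _ (by simp [step, hP, Instr.exec, h]) H

theorem HaltsIn.jlt_pos (hP : P[pc]? = some (.jlt a b l)) (h : (reg a).toNat < (reg b).toNat)
    (H : HaltsIn P t ⟨l, reg, mem⟩ s') : HaltsIn P (t + 1) ⟨pc, reg, mem⟩ s' :=
  .next _ _ _ _ (by simp only [step, hP, Instr.exec, Option.bind_some, if_pos h]) H

theorem HaltsIn.jlt_neg (hP : P[pc]? = some (.jlt a b l)) (h : ¬ (reg a).toNat < (reg b).toNat)
    (H : HaltsIn P t ⟨pc + 1, reg, mem⟩ s') : HaltsIn P (t + 1) ⟨pc, reg, mem⟩ s' :=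
  .next _ _ _ _ (by simp only [step, hP, Instr.exec, Option.bind_some, if_neg h]) H

end Execution

/-- The program that searches in a navigation structure. Register `0` holds the position, register
`1` the address of the current node or of one of its fields, register `2` the number `1`. The loop
starts at instruction `3`. -/
def queryProgram : List Instr :=
  [ .const 2 1, .op .sub 0 0 2, .load 1 3,
    .load 3 1, .op .add 1 1 2, .jeq 0 3 21, .op .add 1 1 2, .op .add 1 1 2, .jlt 0 3 13,
    .op .add 1 1 2, .load 3 1, .op .add 1 1 2, .jlt 0 3 15,
    .load 1 1, .jmp 3,
    .op .add 1 1 2, .load 3 1, .op .add 0 0 3, .op .add 1 1 2, .load 1 1, .jmp 3,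
    .load 0 1, .op .add 1 1 2, .load 1 1, .halt ]

namespace Nav

variable (N : Nav) (w : ℕ)

/-- The memory cells of the node `x`. -/
def field (x : ℕ) : ℕ → BitVec w
  | 0 => BitVec.ofNat w (N.key x)
  | 1 => BitVec.ofNat w (N.ansLen x)
  | 2 => BitVec.ofNat w (N.ansIdx x)
  | 3 => BitVec.ofNat w (8 * N.left x + 8)
  | 4 => BitVec.ofNat w (N.lim x)
  | 5 => BitVec.ofNat w (8 * N.right x + 8)
  | 6 => BitVec.ofNat w (N.off x) - BitVec.ofNat w (N.key x)
  | _ => BitVec.ofNat w (8 * N.target x + 8)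

/-- The data structure: a header with the address of the root, and eight words for each of the
nodes `0, …, K - 1`. -/
def encode (K root : ℕ) : List (BitVec w) :=
  (List.range (8 * K + 8)).map fun a =>
    if a < 8 then BitVec.ofNat w (8 * root + 8) else N.field w (a / 8 - 1) (a % 8)

@[simp] theorem length_encode (K root : ℕ) : (N.encode w K root).length = 8 * K + 8 := by
  simp [encode]

variable {N w}

theorem encode_header (K root : ℕ) :
    (N.encode w K root).getD 0 0 = BitVec.ofNat w (8 * root + 8) := by
  simp [encode, List.getD_eq_getElem?_getD]

theorem encode_field {K root x f a : ℕ} (hx : x < K) (hf : f < 8) (ha : a = 8 * x + 8 + f) :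
    (N.encode w K root).getD a 0 = N.field w x f := by
  have h₁ : a < 8 * K + 8 := by omega
  have h₂ : a / 8 - 1 = x := by omega
  have h₃ : a % 8 = f := by omega
  have h₄ : ¬ a < 8 := by omega
  simp [encode, List.getD_eq_getElem?_getD, h₁, h₂, h₃, h₄]

/-! ### Correctness of the query program -/

theorem Run.halts {K B root m x p y : ℕ} (h : N.Run K B m x p y) (hw : 8 * K + 8 ≤ 2 ^ w)
    (hB : B < 2 ^ w) (reg : ℕ → BitVec w) (mem : BitVec w → BitVec w)
    (hmem : ∀ a, mem a = (N.encode w K root).getD a.toNat 0)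
    (h0 : reg 0 = BitVec.ofNat w p) (h1 : reg 1 = BitVec.ofNat w (8 * x + 8))
    (h2 : reg 2 = BitVec.ofNat w 1) :
    ∃ t s', HaltsIn queryProgram t ⟨3, reg, mem⟩ s' ∧ t ≤ 16 * m + 6 ∧
      s'.reg 0 = BitVec.ofNat w (N.ansLen y) ∧ s'.reg 1 = BitVec.ofNat w (N.ansIdx y) := by
  -- Node addresses do not wrap around, because the whole structure fits into memory.
  have hread : ∀ x f a, x < K → f < 8 → a = 8 * x + 8 + f →
      mem (BitVec.ofNat w a) = N.field w x f := fun x f a hx hf ha => by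
    rw [hmem, BitVec.toNat_ofNat, Nat.mod_eq_of_lt (by omega)]
    exact encode_field hx hf ha
  have hadd : ∀ a, Op.add.eval (BitVec.ofNat w a) (BitVec.ofNat w 1) = BitVec.ofNat w (a + 1) :=
    fun a => (BitVec.ofNat_add a 1).symm
  -- Comparisons of machine words are faithful only for numbers up to `B`; the bounds carried by
  -- `Run` supply this for every comparison made.
  have hval : ∀ a, a ≤ B → (BitVec.ofNat w a).toNat = a := fun a ha => by
    rw [BitVec.toNat_ofNat, Nat.mod_eq_of_lt (by omega)]
  have hne : ∀ a b, a ≤ B → b ≤ B → a ≠ b → BitVec.ofNat w a ≠ BitVec.ofNat w b :=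
    fun a b ha hb hab e => hab (by rw [← hval a ha, e, hval b hb])
  induction h generalizing reg with
  | done x p hx hp h =>
    refine ⟨5 + 1, _, .load (BitVec.ofNat w (N.key x)) rfl ?_ <|
      .op (BitVec.ofNat w (8 * x + 9)) rfl ?_ <| .jeq_pos rfl ?_ <|
      .load (BitVec.ofNat w (N.ansLen x)) rfl ?_ <|
      .op (BitVec.ofNat w (8 * x + 10)) rfl ?_ <|
      .load (BitVec.ofNat w (N.ansIdx x)) rfl ?_ <| .done _ rfl, by omega, ?_, ?_⟩
    · rw [h1, hread x 0 _ hx (by omega) rfl]; rfl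
    · simp [h1, h2, hadd]
    · simp [h0, h]
    · simp only [Function.update_self]
      rw [hread x 1 _ hx (by omega) rfl]; rfl
    · simp [h2, hadd]
    · simp only [Function.update_self]
      rw [hread x 2 _ hx (by omega) rfl]; rfl
    · simp
    · simp
  | left m x p y hx hk h hr ih =>
    -- The registers after one round of the loop: the intermediate values of register `1` have been
    -- overwritten.
    obtain ⟨t, s', hs, ht, hs'⟩ := ih
      (Function.update (Function.update reg 3 (BitVec.ofNat w (N.key x))) 1
        (BitVec.ofNat w (8 * N.left x + 8))) (by simp [h0]) (by simp) (by simp [h2])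
    refine ⟨t + 8, s', .load (BitVec.ofNat w (N.key x)) rfl ?_ <|
      .op (BitVec.ofNat w (8 * x + 9)) rfl ?_ <| .jeq_neg rfl ?_ <|
      .op (BitVec.ofNat w (8 * x + 10)) rfl ?_ <|
      .op (BitVec.ofNat w (8 * x + 11)) rfl ?_ <| .jlt_pos rfl ?_ <|
      .load (BitVec.ofNat w (8 * N.left x + 8)) rfl ?_ <| .jmp rfl ?_, by omega, hs'⟩
    · rw [h1, hread x 0 _ hx (by omega) rfl]; rfl
    · simp [h1, h2, hadd]
    · change reg 0 ≠ BitVec.ofNat w (N.key x)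
      rw [h0]
      exact hne _ _ (by omega) hk (by omega)
    · simp [h2, hadd]
    · simp [h2, hadd]
    · change (reg 0).toNat < (BitVec.ofNat w (N.key x)).toNat
      rw [h0, hval _ (by omega), hval _ hk]
      exact h
    · simp only [Function.update_self]
      rw [hread x 3 _ hx (by omega) rfl]; rfl
    · convert hs using 2
      simp
  | right m x p y hx hp hk h hr ih =>
    obtain ⟨t, s', hs, ht, hs'⟩ := ih
      (Function.update (Function.update reg 3 (BitVec.ofNat w (N.lim x))) 1
        (BitVec.ofNat w (8 * N.right x + 8))) (by simp [h0]) (by simp) (by simp [h2])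
    refine ⟨t + 12, s', .load (BitVec.ofNat w (N.key x)) rfl ?_ <|
      .op (BitVec.ofNat w (8 * x + 9)) rfl ?_ <| .jeq_neg rfl ?_ <|
      .op (BitVec.ofNat w (8 * x + 10)) rfl ?_ <|
      .op (BitVec.ofNat w (8 * x + 11)) rfl ?_ <| .jlt_neg rfl ?_ <|
      .op (BitVec.ofNat w (8 * x + 12)) rfl ?_ <|
      .load (BitVec.ofNat w (N.lim x)) rfl ?_ <|
      .op (BitVec.ofNat w (8 * x + 13)) rfl ?_ <| .jlt_neg rfl ?_ <|
      .load (BitVec.ofNat w (8 * N.right x + 8)) rfl ?_ <| .jmp rfl ?_, by omega, hs'⟩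
    · rw [h1, hread x 0 _ hx (by omega) rfl]; rfl
    · simp [h1, h2, hadd]
    · change reg 0 ≠ BitVec.ofNat w (N.key x)
      rw [h0]
      exact hne _ _ hp (by omega) (by omega)
    · simp [h2, hadd]
    · simp [h2, hadd]
    · change ¬ (reg 0).toNat < (BitVec.ofNat w (N.key x)).toNat
      rw [h0, hval _ hp, hval _ (by omega)]
      omega
    · simp [h2, hadd]
    · simp only [Function.update_self]
      rw [hread x 4 _ hx (by omega) rfl]; rfl
    · simp [h2, hadd]
    · change ¬ (reg 0).toNat < (BitVec.ofNat w (N.lim x)).toNat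
      rw [h0, hval _ hp, hval _ (by omega)]
      omega
    · simp only [Function.update_self]
      rw [hread x 5 _ hx (by omega) rfl]; rfl
    · convert hs using 2
      funext i
      simp only [Function.update_apply]
      split_ifs <;> rfl
  | into m x p y hx hl hk h hr ih =>
    obtain ⟨t, s', hs, ht, hs'⟩ := ih
      (Function.update (Function.update (Function.update reg 3 (N.field w x 6)) 0
        (BitVec.ofNat w (p - N.key x + N.off x))) 1
        (BitVec.ofNat w (8 * N.target x + 8))) (by simp) (by simp) (by simp [h2])
    refine ⟨t + 16, s', .load (BitVec.ofNat w (N.key x)) rfl ?_ <|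
      .op (BitVec.ofNat w (8 * x + 9)) rfl ?_ <| .jeq_neg rfl ?_ <|
      .op (BitVec.ofNat w (8 * x + 10)) rfl ?_ <|
      .op (BitVec.ofNat w (8 * x + 11)) rfl ?_ <| .jlt_neg rfl ?_ <|
      .op (BitVec.ofNat w (8 * x + 12)) rfl ?_ <|
      .load (BitVec.ofNat w (N.lim x)) rfl ?_ <|
      .op (BitVec.ofNat w (8 * x + 13)) rfl ?_ <| .jlt_pos rfl ?_ <|
      .op (BitVec.ofNat w (8 * x + 14)) rfl ?_ <|
      .load (N.field w x 6) rfl ?_ <|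
      .op (BitVec.ofNat w (p - N.key x + N.off x)) rfl ?_ <|
      .op (BitVec.ofNat w (8 * x + 15)) rfl ?_ <|
      .load (BitVec.ofNat w (8 * N.target x + 8)) rfl ?_ <| .jmp rfl ?_, by omega, hs'⟩
    · rw [h1, hread x 0 _ hx (by omega) rfl]; rfl
    · simp [h1, h2, hadd]
    · change reg 0 ≠ BitVec.ofNat w (N.key x)
      rw [h0]
      exact hne _ _ (by omega) (by omega) (by omega)
    · simp [h2, hadd]
    · simp [h2, hadd]
    · change ¬ (reg 0).toNat < (BitVec.ofNat w (N.key x)).toNat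
      rw [h0, hval _ (by omega), hval _ (by omega)]
      omega
    · simp [h2, hadd]
    · simp only [Function.update_self]
      rw [hread x 4 _ hx (by omega) rfl]; rfl
    · simp [h2, hadd]
    · change (reg 0).toNat < (BitVec.ofNat w (N.lim x)).toNat
      rw [h0, hval _ (by omega), hval _ hl]
      exact h
    · simp [h2, hadd]
    · simp only [Function.update_self]
      exact hread x 6 _ hx (by omega) rfl
    -- The stored difference may be negative and is kept modulo `2 ^ w`; adding the position still
    -- gives the right residue.
    · change reg 0 + (BitVec.ofNat w (N.off x) - BitVec.ofNat w (N.key x)) = _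
      obtain ⟨q, rfl⟩ := Nat.exists_eq_add_of_le hk.le
      rw [h0, Nat.add_sub_cancel_left, BitVec.ofNat_add, BitVec.ofNat_add]
      ring
    · simp [h2, hadd]
    · simp only [Function.update_self]
      rw [hread x 7 _ hx (by omega) rfl]; rfl
    · convert hs using 2
      funext i
      simp only [Function.update_apply]
      split_ifs <;> rfl

/-- The program answers a query on the encoded navigation structure. -/
theorem Run.query_halts {K B root m i y : ℕ} (h : N.Run K B m root (i - 1) y) (hi : 1 ≤ i)
    (hw : 8 * K + 8 ≤ 2 ^ w) (hB : B < 2 ^ w) :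
    ∃ t s', HaltsIn queryProgram t (queryConfig (N.encode w K root) i) s' ∧ t ≤ 16 * m + 9 ∧
      s'.reg 0 = BitVec.ofNat w (N.ansLen y) ∧ s'.reg 1 = BitVec.ofNat w (N.ansIdx y) := by
  obtain ⟨t, s', hs, ht, hs'⟩ := h.halts hw hB
    (Function.update (Function.update (Function.update
      (queryConfig (N.encode w K root) i).reg 2 (BitVec.ofNat w 1)) 0 (BitVec.ofNat w (i - 1))) 1
      (BitVec.ofNat w (8 * root + 8)))
    (queryConfig (N.encode w K root) i).mem (fun _ => rfl) (by simp) (by simp) (by simp)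
  refine ⟨t + 3, s', .const _ rfl rfl <| .op (BitVec.ofNat w (i - 1)) rfl ?_ <|
    .load (BitVec.ofNat w (8 * root + 8)) rfl ?_ hs, by omega, hs'⟩
  · change BitVec.ofNat w i - BitVec.ofNat w 1 = _
    obtain ⟨q, rfl⟩ := Nat.exists_eq_add_of_le hi
    rw [Nat.add_sub_cancel_left, BitVec.ofNat_add]
    ring
  -- Register `3` still holds `0`, so the load reads the header cell.
  · exact encode_header K root

end Nav

end LyndonSLP

/-- There are one word-RAM program `P` and one constant `C` such that for every Lyndon word `T` of
length `n` and every Lyndon SLP `G` of `T`, of size `g`, and for every word size `w ≥ lg n + C`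
there is a data structure `D` of at most `C * g` words on which `P` answers, for each position `i`,
in `O(lg n)` steps: it returns in register `0` the length and in register `1` the (index of the)
variable `X` of `G` deriving the longest Lyndon word that starts at position `i`, which is the label
of the highest node of the Lyndon tree of `T` whose leftmost leaf is the `i`-th leaf. -/
theorem mainTheorem4 :
    ∃ (P : List LyndonSLP.Instr) (C : ℕ),
      ∀ (α : Type*) [LinearOrder α] (T : List α) (G : LyndonSLP.SLP α),
        G.IsLyndonSLPOf T →
        ∀ w : ℕ, Nat.clog 2 T.length + C ≤ w →
        ∃ D : List (BitVec w), D.length ≤ C * G.size ∧ D.length ≤ 2 ^ w ∧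
          ∀ i : ℕ, 1 ≤ i → i ≤ T.length →
            ∃ (t : ℕ) (s : LyndonSLP.Config w) (X : Fin G.numVars),
              LyndonSLP.HaltsIn P t (LyndonSLP.queryConfig D i) s ∧
              t ≤ C * (Nat.log 2 T.length + 1) ∧
              (s.reg 0).toNat = (G.val X).length ∧
              (s.reg 1).toNat = X.val ∧
              LyndonSLP.IsLongestLyndonAt T i (G.val X) ∧
              ∃ tree node : LyndonSLP.LTree α,
                LyndonSLP.IsLyndonTree T tree ∧ tree.IsHighestAt i node ∧
                  node.label = G.val X := by
  -- With `k` variables and `L = log n`, the value `64` covers the space `16k + 8 ≤ 24k` and the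
  -- time `16 * 3L + 9`. By `k ≤ 2n` the space is also at most `40n`, which `hpow` bounds by `2 ^
  -- w`.
  refine ⟨LyndonSLP.queryProgram, 64, ?_⟩
  intro α _ T G hG w hw
  obtain ⟨N, root, hN⟩ := G.exists_nav
  have hT : G.len G.start = T.length := by rw [LyndonSLP.SLP.len, hG.represents]
  have hk := LyndonSLP.SLP.numVars_le (G := G)
  have hks := G.numVars_le_size
  have hk0 := G.numVars_pos
  have hn0 := LyndonSLP.SLP.len_pos G.start
  have hpow : 64 * T.length ≤ 2 ^ w :=
    calc 64 * T.length ≤ 2 ^ 64 * 2 ^ Nat.clog 2 T.length :=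
          Nat.mul_le_mul (by norm_num) (Nat.le_pow_clog Nat.one_lt_two _)
      _ = 2 ^ (Nat.clog 2 T.length + 64) := by rw [pow_add, Nat.mul_comm]
      _ ≤ 2 ^ w := Nat.pow_le_pow_right (by norm_num) hw
  rw [hT] at hN hk hn0
  refine ⟨N.encode w (2 * G.numVars) root, ?_, ?_, fun i hi hiT => ?_⟩
  · rw [LyndonSLP.Nav.length_encode]
    omega
  · rw [LyndonSLP.Nav.length_encode]
    omega
  obtain ⟨m, y, hm, hr, hlen, hidx⟩ := hN (i - 1) (by omega)
  obtain ⟨t, s, hs, ht, hs₀, hs₁⟩ := hr.query_halts (w := w) hi (by omega) (by omega)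
  have hi' : i - 1 + 1 = i := Nat.sub_add_cancel hi
  have hlt : i - 1 < G.len G.start := by omega
  refine ⟨t, s, G.highest G.start (i - 1), hs, by omega, ?_, ?_, ?_,
    G.tree G.start, G.tree (G.highest G.start (i - 1)), ?_, ?_, LyndonSLP.SLP.tree_label _⟩
  · have := LyndonSLP.SLP.len_le (G.highest G.start (i - 1))
    rw [hs₀, hlen, BitVec.toNat_ofNat, Nat.mod_eq_of_lt (by omega)]
    rfl
  · have := (G.highest G.start (i - 1)).isLt
    rw [hs₁, hidx, BitVec.toNat_ofNat, Nat.mod_eq_of_lt (by omega)]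
  · have := hG.isLongestLyndonAt G.start (i - 1) hlt
    rwa [hi', hG.represents] at this
  · have := hG.isLyndonTree G.start
    rwa [hG.represents] at this
  · have := LyndonSLP.SLP.isHighestAt_tree G.start (i - 1) hlt
    rwa [hi'] at this
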